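/- Let $S\subset\mathbb{R}^2$ be compact, let $\alpha,\beta\in(-1,1)$ and $\delta t>0$, and for $s\in S$ put $M_s=\exp\bigl(\max_{u\in S}\|s^2-u^2\|^2\bigr)$, where $v^2=(v_1^2,v_2^2)$ for $v=(v_1,v_2)$. On a probability space let $X(s,0)$, $s\in S$, and $Y(s,0)$, $s\in S$, and $V(u)$, $u\in\mathbb{R}$, be real stochastic processes (no independence is required) such that: A1. $X(\cdot,0)$ is a centered Gaussian process whose (symmetric, nonnegative definite) covariance function has bounded first-order partial derivatives, i.e. it extends to an open neighbourhood of $S\times S$ in $\mathbb{R}^2\times\mathbb{R}^2$ on which all first-order partial derivatives exist and are bounded. A2. The same holds for $Y(\cdot,0)$. A3. $V$ is a centered Gaussian process whose covariance function $c(x_1,x_2)$ is twice continuously differentiable on $\mathbb{R}^2$, with Lipschitz continuous mixed partial derivative $\partial^2c/\partial x_1\partial x_2$. (For example, squared exponential covariance functions are allowed in A1–A3.) As usual, sample path properties refer to separable versions: a process $Z$ indexed by $T$ is separable if there is a countable $D\subset T$ such that, almost surely, every point $(t,Z(t))$, $t\in T$, of the graph is a limit of points $(d,Z(d))$ with $d\in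 D$. A version (modification) of $Z$ is a process $\tilde Z$ with $\tilde Z(t)=Z(t)$ almost surely, for every $t\in T$. Then $X(\cdot,0)$, $Y(\cdot,0)$ and $V$ have separable versions. If they are replaced by any separable versions, then almost surely $V$ is differentiable on $\mathbb{R}$ and, for the processes defined for $s\in S$ and integers $h\ge 0$ by $$Y(s,(h+1)\delta t)=\beta\,Y(s,h\delta t)+\delta t\,M_s^{-1}\Bigl(\alpha X(s,h\delta t)-\tfrac{\delta t}{2}V'(Y(s,h\delta t))\Bigr),$$ $$X(s,(h+1)\delta t)=\alpha^2X(s,h\delta t)-\tfrac{\delta t}{2}\Bigl(\alpha V'(Y(s,h\delta t))+V'(Y(s,(h+1)\delta t))\Bigr),$$ the sample paths $s\mapsto Y(s,h\delta t)$ and $s\mapsto X(s,h\delta t)$ are, with probability one, continuous on $S$ for all $h\ge 1$. -/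

import Mathlib

open MeasureTheory ProbabilityTheory

noncomputable section

namespace HamiltonianST

/-- The Euclidean plane, in which the spatial locations lie. -/
abbrev Plane : Type := EuclideanSpace ℝ (Fin 2)

/-- Coordinatewise square `v² = (v₁², v₂²)`. -/
def sqVec (v : Plane) : Plane := !₂[(v 0) ^ 2, (v 1) ^ 2]

/-- The mass `M_s = exp (max {‖s² - u²‖² : u ∈ S})`; for `s ∈ S` and `S` compact the supremum
is a maximum. -/
def mass (S : Set Plane) (s : Plane) : ℝ :=
  Real.exp (sSup ((fun u : Plane => ‖sqVec s - sqVec u‖ ^ 2) '' S))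

/-- The state `(Y(·, h δt), X(·, h δt))` after `h` steps of the modified leap-frog scheme, started
from `y₀ = Y(·, 0)` and `x₀ = X(·, 0)`, for one realization `v` of the random function `V`:
`Y(s, t + δt) = β Y(s, t) + δt M_s⁻¹ (α X(s, t) - (δt / 2) V'(Y(s, t)))` and
`X(s, t + δt) = α² X(s, t) - (δt / 2) (α V'(Y(s, t)) + V'(Y(s, t + δt)))`. -/
def leapfrog (S : Set Plane) (α β δt : ℝ) (v : ℝ → ℝ) (y₀ x₀ : S → ℝ) :
    ℕ → (S → ℝ) × (S → ℝ)
  | 0 => (y₀, x₀)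
  | h + 1 =>
    let y : S → ℝ := (leapfrog S α β δt v y₀ x₀ h).1
    let x : S → ℝ := (leapfrog S α β δt v y₀ x₀ h).2
    let y' : S → ℝ := fun s =>
      β * y s + δt * (mass S s)⁻¹ * (α * x s - δt / 2 * deriv v (y s))
    let x' : S → ℝ := fun s =>
      α ^ 2 * x s - δt / 2 * (α * deriv v (y s) + deriv v (y' s))
    (y', x')

section Processes

variable {Ω : Type*} [MeasurableSpace Ω]

/-- The observed process `Y(s, h δt)`, driven by the random function `V` and the initial
processes `Y₀ = Y(·, 0)` and `X₀ = X(·, 0)`. -/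
def obsProcess (S : Set Plane) (α β δt : ℝ) (V : ℝ → Ω → ℝ) (Y₀ X₀ : S → Ω → ℝ)
    (h : ℕ) (s : S) (ω : Ω) : ℝ :=
  (leapfrog S α β δt (fun u => V u ω) (fun s => Y₀ s ω) (fun s => X₀ s ω) h).1 s

/-- The latent process `X(s, h δt)`. -/
def latProcess (S : Set Plane) (α β δt : ℝ) (V : ℝ → Ω → ℝ) (Y₀ X₀ : S → Ω → ℝ)
    (h : ℕ) (s : S) (ω : Ω) : ℝ :=
  (leapfrog S α β δt (fun u => V u ω) (fun s => Y₀ s ω) (fun s => X₀ s ω) h).2 s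

/-- A centered Gaussian process. -/
structure IsCenteredGaussian {T : Type*} (Z : T → Ω → ℝ) (P : Measure Ω) : Prop where
  gaussian : IsGaussianProcess Z P
  centered : ∀ t, ∫ ω, Z t ω ∂P = 0

/-- The function `c` on `S × S` has bounded (first order) partial derivatives: as usual for a
function on a set that need not be open, `c` is the restriction of a function on an open
neighbourhood `U` of `S × S` all of whose partial derivatives exist and are bounded on `U`. -/
def HasBoundedPartials (S : Set Plane) (c : S → S → ℝ) : Prop :=
  ∃ (U : Set (Plane × Plane)) (f : Plane × Plane → ℝ) (K : ℝ),
    IsOpen U ∧ S ×ˢ S ⊆ U ∧ (∀ s t : S, f ((s : Plane), (t : Plane)) = c s t) ∧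
    ∀ p ∈ U, ∀ i : Fin 2,
      LineDifferentiableAt ℝ f p (EuclideanSpace.single i 1, 0) ∧
      |lineDeriv ℝ f p (EuclideanSpace.single i 1, 0)| ≤ K ∧
      LineDifferentiableAt ℝ f p (0, EuclideanSpace.single i 1) ∧
      |lineDeriv ℝ f p (0, EuclideanSpace.single i 1)| ≤ K

/-- The assumption on each of the initial processes `X(·, 0)` and `Y(·, 0)`: a centered Gaussian
process on `S` whose covariance function has bounded partial derivatives. (A covariance function
is always symmetric and nonnegative definite.) -/
structure InitialAssumption (S : Set Plane) (Z : S → Ω → ℝ) (P : Measure Ω) : Prop where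
  centeredGaussian : IsCenteredGaussian Z P
  boundedPartials : HasBoundedPartials S (fun s t => covariance (Z s) (Z t) P)

/-- The assumption on the random function `V`: a centered Gaussian process on `ℝ` whose covariance
function `c` is twice continuously differentiable, with Lipschitz mixed partial derivative
`∂²c / ∂x₁∂x₂`. -/
structure PotentialAssumption (V : ℝ → Ω → ℝ) (P : Measure Ω) : Prop where
  centeredGaussian : IsCenteredGaussian V P
  contDiff_cov : ContDiff ℝ 2 (fun p : ℝ × ℝ => covariance (V p.1) (V p.2) P)
  lipschitz_mixed : ∃ K, LipschitzWith K (fun p : ℝ × ℝ =>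
    deriv (fun x₁ => deriv (fun x₂ => covariance (V x₁) (V x₂) P) p.2) p.1)

/-- `Z'` is a modification (version) of `Z`. -/
def IsModification {T : Type*} (Z' Z : T → Ω → ℝ) (P : Measure Ω) : Prop :=
  ∀ t, Z' t =ᵐ[P] Z t

/-- Separability in the sense of Doob: there is a countable set `D` of indices such that almost
every sample path is determined by its restriction to `D`, in that each point `(t, Z t ω)` of its
graph is a limit of points `(d, Z d ω)` with `d ∈ D`. -/
def IsSeparableProcess {T : Type*} [TopologicalSpace T] (Z : T → Ω → ℝ) (P : Measure Ω) : Prop :=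
  ∃ D : Set T, D.Countable ∧
    ∀ᵐ ω ∂P, ∀ t, (t, Z t ω) ∈ closure ((fun d => (d, Z d ω)) '' D)

end Processes

end HamiltonianST

end

noncomputable section

namespace HamiltonianST

open Filter Topology

/-! ### A Kolmogorov continuity criterion on countable index sets -/

/-! Each step of the recursion only composes continuous maps, so everything follows once almost
surely `X(·,0)` and `Y(·,0)` are continuous and `V` is continuously differentiable
(`continuous_leapfrog`).

Both facts come from one Kolmogorov criterion for index sets in the plane,
`ae_uniformContinuous_of_gaussian`: if increments have variance `O(d)` at distance `d`, their
twentieth moments are `O(d ^ 10)`, which is ample for chaining over planar grids. For the initial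
processes the variance of an increment is a sum of two increments of the covariance, controlled by
its partial derivatives (`exists_abs_sub_diag_le`). For `V` the criterion is applied to the
difference quotients, indexed by pairs of distinct reals. Their covariances are averages of the
mixed partial over rectangles, so its Lipschitz constant bounds the variances
(`abs_mixed_difference_sub_le`). The quotients then extend continuously across the diagonal, where
their values are the derivative (`exists_contDiff_extension`).

Chaining controls only countably many indices. Separability removes this restriction: the graph of a
path lies in the closure of its part over a countable set, hence in the closed graph of the
continuous extension (`IsSeparableProcess.ae_eq_of_extension`). Conversely, extending from a
countable dense set produces separable versions (`exists_separable_version`). -/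

/-- A Borel–Cantelli lemma with a summable real majorant valid from some index on. -/
lemma ae_eventually_notMem_of_summable {Ω : Type*} [MeasurableSpace Ω] {P : Measure Ω}
    {s : ℕ → Set Ω} {u : ℕ → ℝ} (hu : Summable u)
    (h : ∀ᶠ n in atTop, P (s n) ≤ ENNReal.ofReal (u n)) :
    ∀ᵐ ω ∂P, ∀ᶠ n in atTop, ω ∉ s n := by
  obtain ⟨N, hN⟩ := eventually_atTop.1 h
  have hsum : ∑' n, P (s (n + N)) ≠ ⊤ := by
    refine ne_top_of_le_ne_top ((summable_nat_add_iff N).2 hu).tsum_ofReal_ne_top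
      (ENNReal.tsum_le_tsum fun n => hN _ (Nat.le_add_left _ _))
  filter_upwards [ae_eventually_notMem hsum] with ω hω
  obtain ⟨m, hm⟩ := eventually_atTop.1 hω
  refine eventually_atTop.2 ⟨m + N, fun n hn => ?_⟩
  have := hm (n - N) (by omega)
  rwa [Nat.sub_add_cancel (by omega)] at this

/-- Round both coordinates down to a grid of mesh `16⁻ⁿ` and pick one representative index in each
occupied cell. The representatives are genuine indices, as chaining requires. -/
lemma exists_finite_net {ι : Type*} (φ : ι → ℝ × ℝ) (R : ℕ)
    (hφ : ∀ i, |(φ i).1| ≤ R ∧ |(φ i).2| ≤ R) (n : ℕ) :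
    ∃ (π : ι → ι) (G : Finset ι), (G.card : ℝ) ≤ (2 * R + 1) ^ 2 * 256 ^ n ∧
      ∀ i, π i ∈ G ∧ dist (φ i) (φ (π i)) ≤ (1 / 16) ^ n := by
  classical
  rcases isEmpty_or_nonempty ι with hι | hι
  · exact ⟨id, ∅, by simp; positivity, fun i => (hι.false i).elim⟩
  set m : ℝ := 16 ^ n with hm
  have hm0 : 0 < m := by positivity
  let cell : ι → ℤ × ℤ := fun i => (⌊(φ i).1 * m⌋, ⌊(φ i).2 * m⌋)
  let r : ℤ × ℤ → ι := Function.invFun cell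
  have hr : ∀ i, cell (r (cell i)) = cell i := fun i => Function.invFun_eq ⟨i, rfl⟩
  let K : Finset ℤ := Finset.Icc (-(R * 16 ^ n : ℤ)) (R * 16 ^ n)
  have hK : (K.card : ℝ) ≤ (2 * R + 1) * 16 ^ n := by
    have h1 : (K.card : ℤ) = 2 * (R * 16 ^ n) + 1 := by
      simp only [K, Int.card_Icc]
      have : (0 : ℤ) ≤ R * 16 ^ n := by positivity
      rw [Int.toNat_of_nonneg (by linarith)]; ring
    have h2 : (K.card : ℝ) = 2 * (R * 16 ^ n) + 1 := by exact_mod_cast h1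
    have h3 : (1 : ℝ) ≤ 16 ^ n := one_le_pow₀ (by norm_num)
    rw [h2]; linarith
  have hmem : ∀ x : ℝ, |x| ≤ R → ⌊x * m⌋ ∈ K := by
    intro x hx
    obtain ⟨h1, h2⟩ := abs_le.1 hx
    refine Finset.mem_Icc.2 ⟨Int.le_floor.2 ?_, Int.floor_le_iff.2 ?_⟩
    · push_cast; rw [← hm]; nlinarith
    · push_cast; rw [← hm]; nlinarith
  have hclose : ∀ x y : ℝ, ⌊x * m⌋ = ⌊y * m⌋ → |x - y| ≤ (1 / 16) ^ n := by
    intro x y h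
    have h1 := Int.abs_sub_lt_one_of_floor_eq_floor h
    rw [← sub_mul, abs_mul, abs_of_pos hm0] at h1
    rw [one_div, inv_pow, ← hm]
    rw [← one_div, le_div_iff₀ hm0]
    exact h1.le
  refine ⟨fun i => r (cell i), (K ×ˢ K).image r, ?_, fun i => ⟨?_, ?_⟩⟩
  · calc (((K ×ˢ K).image r).card : ℝ) ≤ ((K ×ˢ K).card : ℝ) := by
          exact_mod_cast Finset.card_image_le
      _ = (K.card : ℝ) ^ 2 := by rw [Finset.card_product]; push_cast; ring
      _ ≤ ((2 * R + 1) * 16 ^ n) ^ 2 := by gcongr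
      _ = (2 * R + 1) ^ 2 * 256 ^ n := by
          rw [mul_pow, ← pow_mul, mul_comm n 2, pow_mul]; norm_num
  · exact Finset.mem_image_of_mem _
      (Finset.mem_product.2 ⟨hmem _ (hφ i).1, hmem _ (hφ i).2⟩)
  · have h := Prod.ext_iff.1 (hr i)
    rw [Prod.dist_eq, max_le_iff, Real.dist_eq, Real.dist_eq]
    exact ⟨hclose _ _ h.1.symm, hclose _ _ h.2.symm⟩

/-- Chaining along a sequence of nets, for a single sample path. -/
lemma abs_sub_le_of_chain {ι : Type*} {φ : ι → ℝ × ℝ} {π : ℕ → ι → ι} {G : ℕ → Finset ι}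
    (hG : ∀ n i, π n i ∈ G n ∧ dist (φ i) (φ (π n i)) ≤ (1 / 16) ^ n) {z : ι → ℝ} {n₀ : ℕ}
    (hz : ∀ n ≥ n₀, ∀ a ∈ G n, ∀ b, b ∈ G n ∨ b ∈ G (n + 1) →
      dist (φ a) (φ b) ≤ 3 * (1 / 16) ^ n → |z a - z b| ≤ (1 / 2) ^ n)
    (hlim : ∀ i, Tendsto (fun n => z (π n i)) atTop (𝓝 (z i)))
    {n : ℕ} (hn : n₀ ≤ n) {i j : ι} (hij : dist (φ i) (φ j) ≤ (1 / 16) ^ n) :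
    |z i - z j| ≤ 5 * (1 / 2) ^ n := by
  -- Telescoping along the nets `n, n + 1, …` costs `∑ₖ 2⁻⁽ⁿ⁺ᵏ⁾ = 2 · 2⁻ⁿ`. The final constant 5 is
  -- two such tails plus one step `2⁻ⁿ` inside the net.
  have key : ∀ i, |z (π n i) - z i| ≤ 2 * (1 / 2) ^ n := by
    intro i
    have h := dist_le_of_le_geometric_two_of_tendsto₀ (C := 2 * (1 / 2) ^ n)
      (f := fun k => z (π (n + k) i)) (fun k => ?_) (a := z i) ?_
    · simpa [Real.dist_eq] using h
    · rw [Real.dist_eq]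
      refine (hz (n + k) (by omega) _ (hG _ i).1 _ (Or.inr (hG _ i).1) ?_).trans (le_of_eq ?_)
      · have h1 := (hG (n + k) i).2
        have h2 := (hG (n + k + 1) i).2
        have h3 := dist_triangle_left (φ (π (n + k) i)) (φ (π (n + k + 1) i)) (φ i)
        have h4 : ((1 : ℝ) / 16) ^ (n + k + 1) ≤ (1 / 16) ^ (n + k) :=
          pow_le_pow_of_le_one (by norm_num) (by norm_num) (by omega)
        have h5 : (0 : ℝ) ≤ (1 / 16) ^ (n + k) := by positivity
        exact h3.trans (by linarith)
      · rw [pow_add, one_div_pow (2 : ℝ) k]; ring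
    · exact (hlim i).comp (tendsto_atTop_mono (fun k => Nat.le_add_left k n) tendsto_id)
  have hmid : |z (π n i) - z (π n j)| ≤ (1 / 2) ^ n := by
    refine hz n hn _ (hG n i).1 _ (Or.inl (hG n j).1) ?_
    have h1 := (hG n i).2
    have h2 := (hG n j).2
    have h3 := dist_triangle4 (φ (π n i)) (φ i) (φ j) (φ (π n j))
    rw [dist_comm (φ (π n i)) (φ i)] at h3
    linarith
  have h1 := abs_le.1 (key i)
  have h2 := abs_le.1 (key j)
  have h3 := abs_le.1 hmid
  rw [abs_le]
  constructor <;> linarith [h1.1, h1.2, h2.1, h2.2, h3.1, h3.2]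

/-- Kolmogorov's continuity criterion: on a countable index set that is (pseudo-metrically)
a bounded subset of the plane, a tenth order tail bound makes almost all paths uniformly
continuous. -/
theorem ae_uniformContinuous_of_tail {Ω ι : Type*} [MeasurableSpace Ω] {P : Measure Ω}
    [Countable ι] {φ : ι → ℝ × ℝ} {R : ℕ} (hφ : ∀ i, |(φ i).1| ≤ R ∧ |(φ i).2| ≤ R)
    {Z : ι → Ω → ℝ} {M δ : ℝ} (hM : 0 ≤ M) (hδ : 0 < δ)
    (tail : ∀ i j, dist (φ i) (φ j) < δ → ∀ r > 0,
      P {ω | r ≤ |Z i ω - Z j ω|} ≤ ENNReal.ofReal (M * dist (φ i) (φ j) ^ 10 / r ^ 20)) :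
    ∀ᵐ ω ∂P, ∀ ε > 0, ∃ η > 0, ∀ i j, dist (φ i) (φ j) < η → |Z i ω - Z j ω| < ε := by
  classical
  choose π G hcard hG using exists_finite_net φ R hφ
  set C : ℝ := (2 * R + 1) ^ 2 with hC
  have hC0 : 0 ≤ C := by positivity
  have hscale : ∀ᶠ n in atTop, 3 * ((1 : ℝ) / 16) ^ n < δ := by
    have : Tendsto (fun n : ℕ => 3 * ((1 : ℝ) / 16) ^ n) atTop (𝓝 (3 * 0)) :=
      (tendsto_pow_atTop_nhds_zero_of_lt_one (by norm_num) (by norm_num)).const_mul 3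
    rw [mul_zero] at this
    exact this.eventually_lt_const hδ
  -- At distance `3 · 16⁻ⁿ` and threshold `2⁻ⁿ` the tail decays like `(16⁻¹⁰ · 2²⁰)ⁿ = 2⁻²⁰ⁿ`.
  have tail' : ∀ n, 3 * ((1 : ℝ) / 16) ^ n < δ → ∀ i j,
      dist (φ i) (φ j) ≤ 3 * (1 / 16) ^ n →
      P {ω | (1 / 2) ^ n ≤ |Z i ω - Z j ω|} ≤ ENNReal.ofReal (M * 3 ^ 10 * (1 / 2 ^ 20) ^ n) := by
    intro n hn i j hij
    refine (tail i j (hij.trans_lt hn) ((1 / 2) ^ n) (by positivity)).trans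
      (ENNReal.ofReal_le_ofReal ?_)
    calc M * dist (φ i) (φ j) ^ 10 / ((1 / 2) ^ n) ^ 20
        ≤ M * (3 * (1 / 16) ^ n) ^ 10 / ((1 / 2) ^ n) ^ 20 := by gcongr
      _ = M * 3 ^ 10 * (((1 / 16) ^ 10 / (1 / 2) ^ 20) ^ n) := by
          rw [mul_pow, div_pow ((1 / 16 : ℝ) ^ 10), pow_right_comm (1 / 16 : ℝ) n,
            pow_right_comm (1 / 2 : ℝ) n]
          ring
      _ = M * 3 ^ 10 * (1 / 2 ^ 20) ^ n := by norm_num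
  -- Nothing is known yet about the paths, so convergence along the nets needs its own
  -- Borel–Cantelli argument for each index; countability of `ι` combines the null sets.
  have hsingle : ∀ᵐ ω ∂P, ∀ i, Tendsto (fun n => Z (π n i) ω) atTop (𝓝 (Z i ω)) := by
    refine ae_all_iff.2 fun i => ?_
    have hae : ∀ᵐ ω ∂P, ∀ᶠ n in atTop,
        ω ∉ {ω | ((1 : ℝ) / 2) ^ n ≤ |Z i ω - Z (π n i) ω|} := by
      refine ae_eventually_notMem_of_summable
        ((summable_geometric_of_lt_one (r := (1 : ℝ) / 2 ^ 20) (by norm_num)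
          (by norm_num)).mul_left (M * 3 ^ 10)) ?_
      filter_upwards [hscale] with n hn
      refine tail' n hn i _ ((hG n i).2.trans ?_)
      have : (0 : ℝ) ≤ (1 / 16) ^ n := by positivity
      linarith
    filter_upwards [hae] with ω hω
    refine tendsto_iff_dist_tendsto_zero.2 (squeeze_zero' (Eventually.of_forall fun _ =>
      dist_nonneg) ?_ (tendsto_pow_atTop_nhds_zero_of_lt_one (r := (1 : ℝ) / 2) (by norm_num)
        (by norm_num)))
    filter_upwards [hω] with n hn
    rw [dist_comm, Real.dist_eq]
    exact (not_le.1 hn).le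
  -- A crude union bound over all pairs: about `256ⁿ · 256ⁿ = 2¹⁶ⁿ` of them against `2⁻²⁰ⁿ` leaves
  -- the summable `16⁻ⁿ`. This is what the tenth power of the distance pays for.
  have hnet : ∀ᵐ ω ∂P, ∀ᶠ n in atTop, ω ∉ ⋃ a ∈ G n, ⋃ b ∈ G n ∪ G (n + 1),
      {ω | dist (φ a) (φ b) ≤ 3 * (1 / 16) ^ n ∧ (1 / 2) ^ n ≤ |Z a ω - Z b ω|} := by
    refine ae_eventually_notMem_of_summable (u := fun n =>
      (C * (257 * C) * (M * 3 ^ 10)) * (1 / 16) ^ n)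
      ((summable_geometric_of_lt_one (by norm_num) (by norm_num)).mul_left _) ?_
    filter_upwards [hscale] with n hn
    set B : ℝ := M * 3 ^ 10 * (1 / 2 ^ 20) ^ n with hB
    have hB0 : 0 ≤ B := by positivity
    have hpair : ∀ a b, P {ω | dist (φ a) (φ b) ≤ 3 * (1 / 16) ^ n ∧
        (1 / 2) ^ n ≤ |Z a ω - Z b ω|} ≤ ENNReal.ofReal B := by
      intro a b
      by_cases hab : dist (φ a) (φ b) ≤ 3 * (1 / 16) ^ n
      · exact (measure_mono fun ω hω => hω.2).trans (tail' n hn a b hab)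
      · simp only [hab, false_and, Set.ofPred_false, measure_empty, zero_le]
    have hH : ((G n ∪ G (n + 1)).card : ℝ) ≤ 257 * C * 256 ^ n := by
      calc ((G n ∪ G (n + 1)).card : ℝ) ≤ (G n).card + (G (n + 1)).card := by
            exact_mod_cast Finset.card_union_le _ _
        _ ≤ C * 256 ^ n + C * 256 ^ (n + 1) := add_le_add (hcard n) (hcard (n + 1))
        _ = 257 * C * 256 ^ n := by ring
    calc P (⋃ a ∈ G n, ⋃ b ∈ G n ∪ G (n + 1), _)
        ≤ ∑ a ∈ G n, ∑ b ∈ G n ∪ G (n + 1), ENNReal.ofReal B :=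
          (measure_biUnion_finset_le _ _).trans (Finset.sum_le_sum fun a _ =>
            (measure_biUnion_finset_le _ _).trans (Finset.sum_le_sum fun b _ => hpair a b))
      _ = ENNReal.ofReal (((G n).card : ℝ) * (((G n ∪ G (n + 1)).card : ℝ) * B)) := by
          simp only [Finset.sum_const, nsmul_eq_mul]
          rw [ENNReal.ofReal_mul (Nat.cast_nonneg _), ENNReal.ofReal_mul (Nat.cast_nonneg _),
            ENNReal.ofReal_natCast, ENNReal.ofReal_natCast]
      _ ≤ ENNReal.ofReal ((C * (257 * C) * (M * 3 ^ 10)) * (1 / 16) ^ n) := by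
          refine ENNReal.ofReal_le_ofReal ?_
          calc ((G n).card : ℝ) * (((G n ∪ G (n + 1)).card : ℝ) * B)
              ≤ (C * 256 ^ n) * ((257 * C * 256 ^ n) * B) := by
                gcongr
                exact hcard n
            _ = (C * (257 * C) * (M * 3 ^ 10)) * (256 * 256 * (1 / 2 ^ 20)) ^ n := by
                rw [hB, mul_pow, mul_pow]; ring
            _ = (C * (257 * C) * (M * 3 ^ 10)) * (1 / 16) ^ n := by norm_num
  filter_upwards [hsingle, hnet] with ω h1 h2 ε hε
  obtain ⟨n₀, hn₀⟩ := eventually_atTop.1 h2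
  have hsmall : ∀ᶠ n in atTop, 5 * ((1 : ℝ) / 2) ^ n < ε := by
    have : Tendsto (fun n : ℕ => 5 * ((1 : ℝ) / 2) ^ n) atTop (𝓝 (5 * 0)) :=
      (tendsto_pow_atTop_nhds_zero_of_lt_one (by norm_num) (by norm_num)).const_mul 5
    rw [mul_zero] at this
    exact this.eventually_lt_const hε
  obtain ⟨n, hn, hn'⟩ := (hsmall.and (eventually_ge_atTop n₀)).exists
  refine ⟨(1 / 16) ^ n, by positivity, fun i j hij => lt_of_le_of_lt ?_ hn⟩
  refine abs_sub_le_of_chain (z := fun i => Z i ω) hG (n₀ := n₀) ?_ h1 hn' hij.le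
  intro m hm a ha b hb hab
  have := hn₀ m hm
  simp only [Set.mem_iUnion, not_exists] at this
  have := this a ha b (Finset.mem_union.2 hb)
  exact (not_le.1 fun h => this ⟨hab, h⟩).le

/-! ### Gaussian processes -/

/-- The twentieth moment of the standard normal distribution. -/
def gaussianMoment : ℝ := ∫ x, x ^ 20 ∂gaussianReal 0 1

lemma gaussianMoment_nonneg : 0 ≤ gaussianMoment :=
  integral_nonneg fun x => Even.pow_nonneg (by decide) x

/-- Chebyshev's inequality of order twenty for a centered normal variable. -/
lemma measure_abs_ge_le_of_gaussian {Ω : Type*} [MeasurableSpace Ω] {P : Measure Ω}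
    {Y : Ω → ℝ} (hY : HasGaussianLaw Y P) (h0 : ∫ ω, Y ω ∂P = 0) {v : ℝ}
    (hv : Var[Y; P] ≤ v) {r : ℝ} (hr : 0 < r) :
    P {ω | r ≤ |Y ω|} ≤ ENNReal.ofReal (gaussianMoment * v ^ 10 / r ^ 20) := by
  have := hY.isProbabilityMeasure
  have hvar : 0 ≤ Var[Y; P] := variance_nonneg _ _
  -- Scaling from the standard normal turns the twentieth moment into a constant times the tenth
  -- power of the variance, and also covers variance zero.
  have hmap : P.map Y = (gaussianReal 0 1).map (√(Var[Y; P]) * ·) := by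
    rw [hY.map_eq_gaussianReal, h0, gaussianReal_map_const_mul, mul_zero, mul_one]
    congr 1
    ext
    simp [Real.sq_sqrt hvar, hvar]
  have hmoment : ∫ ω, Y ω ^ 20 ∂P = Var[Y; P] ^ 10 * gaussianMoment := by
    rw [← integral_map (φ := Y) (f := fun x => x ^ 20) hY.aemeasurable (by fun_prop), hmap,
      integral_map (by fun_prop) (by fun_prop), gaussianMoment, ← integral_const_mul]
    congr 1 with x
    rw [mul_pow, show √(Var[Y; P]) ^ 20 = (√(Var[Y; P]) ^ 2) ^ 10 by ring, Real.sq_sqrt hvar]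
  have hint : Integrable (fun ω => Y ω ^ 20) P := by
    have h := (hY.memLp (p := 20) (by norm_num)).integrable_norm_pow (by norm_num)
    refine h.congr (Eventually.of_forall fun ω => ?_)
    simp [Even.pow_abs (show Even 20 by decide)]
  have hmark := mul_meas_ge_le_integral_of_nonneg (μ := P) (f := fun ω => Y ω ^ 20)
    (Eventually.of_forall fun ω => Even.pow_nonneg (by decide) _) hint (r ^ 20)
  have hset : {ω | r ≤ |Y ω|} ⊆ {ω | r ^ 20 ≤ Y ω ^ 20} := fun ω hω => by
    have : r ^ 20 ≤ |Y ω| ^ 20 := pow_le_pow_left₀ hr.le hω _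
    rwa [Even.pow_abs (by decide)] at this
  refine (measure_mono hset).trans ?_
  rw [← ofReal_measureReal]
  refine ENNReal.ofReal_le_ofReal ?_
  rw [le_div_iff₀ (by positivity), mul_comm]
  refine hmark.trans ?_
  rw [hmoment, mul_comm]
  gcongr
  exact gaussianMoment_nonneg

theorem ae_uniformContinuous_of_gaussian {Ω ι : Type*} [MeasurableSpace Ω] {P : Measure Ω}
    [Countable ι] {φ : ι → ℝ × ℝ} {R : ℕ} (hφ : ∀ i, |(φ i).1| ≤ R ∧ |(φ i).2| ≤ R)
    {Z : ι → Ω → ℝ} (hZ : IsCenteredGaussian Z P) {C δ : ℝ} (hδ : 0 < δ)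
    (hvar : ∀ i j, dist (φ i) (φ j) < δ → Var[Z i - Z j; P] ≤ C * dist (φ i) (φ j)) :
    ∀ᵐ ω ∂P, ∀ ε > 0, ∃ η > 0, ∀ i j, dist (φ i) (φ j) < η → |Z i ω - Z j ω| < ε := by
  -- The even exponent makes the constant nonnegative whatever the sign of `C`.
  refine ae_uniformContinuous_of_tail (M := gaussianMoment * C ^ 10) hφ
    (mul_nonneg gaussianMoment_nonneg (Even.pow_nonneg (by decide) _)) hδ
    fun i j hij r hr => ?_
  have h0 : ∫ ω, (Z i - Z j) ω ∂P = 0 := by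
    simp only [Pi.sub_apply]
    rw [integral_sub (hZ.gaussian.hasGaussianLaw_eval i).integrable
      (hZ.gaussian.hasGaussianLaw_eval j).integrable, hZ.centered, hZ.centered, sub_zero]
  refine (measure_abs_ge_le_of_gaussian hZ.gaussian.hasGaussianLaw_sub h0
    (hvar i j hij) hr).trans (le_of_eq ?_)
  rw [mul_pow, mul_assoc]

/-! ### Invariance of the assumptions under modification -/

section Modification

variable {Ω T : Type*} [MeasurableSpace Ω] {P : Measure Ω} {Z Z' : T → Ω → ℝ}

lemma IsModification.covariance_eq (h : IsModification Z' Z P) (s t : T) :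
    covariance (Z' s) (Z' t) P = covariance (Z s) (Z t) P := by
  simp only [covariance, integral_congr_ae (h s), integral_congr_ae (h t)]
  refine integral_congr_ae ?_
  filter_upwards [h s, h t] with ω h1 h2
  rw [h1, h2]

lemma IsCenteredGaussian.congr (hZ : IsCenteredGaussian Z P) (h : IsModification Z' Z P) :
    IsCenteredGaussian Z' P :=
  ⟨hZ.gaussian.congr fun t => (h t).symm, fun t => by rw [integral_congr_ae (h t), hZ.centered]⟩

lemma IsCenteredGaussian.comp {T' : Type*} (hZ : IsCenteredGaussian Z P) (f : T' → T) :
    IsCenteredGaussian (fun i => Z (f i)) P :=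
  ⟨hZ.gaussian.comp_right f, fun _ => hZ.centered _⟩

lemma IsCenteredGaussian.memLp (hZ : IsCenteredGaussian Z P) (t : T) : MemLp (Z t) 2 P :=
  (hZ.gaussian.hasGaussianLaw_eval t).memLp_two

/-- Grouped so that each bracket varies only the second argument of the covariance, starting from
the diagonal. -/
lemma IsCenteredGaussian.variance_sub (hZ : IsCenteredGaussian Z P) (s t : T) :
    Var[Z s - Z t; P] = (covariance (Z s) (Z s) P - covariance (Z s) (Z t) P) +
      (covariance (Z t) (Z t) P - covariance (Z t) (Z s) P) := by
  have := hZ.gaussian.isProbabilityMeasure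
  rw [ProbabilityTheory.variance_sub (hZ.memLp s) (hZ.memLp t),
    covariance_self (hZ.gaussian.aemeasurable s), covariance_self (hZ.gaussian.aemeasurable t),
    covariance_comm (Z t) (Z s)]
  ring

lemma InitialAssumption.congr {Ω : Type*} [MeasurableSpace Ω] {P : Measure Ω} {S : Set Plane}
    {Z Z' : S → Ω → ℝ} (hZ : InitialAssumption S Z P) (h : IsModification Z' Z P) :
    InitialAssumption S Z' P where
  centeredGaussian := hZ.centeredGaussian.congr h
  boundedPartials := by
    simp only [h.covariance_eq]
    exact hZ.boundedPartials

lemma PotentialAssumption.congr {Ω : Type*} [MeasurableSpace Ω] {P : Measure Ω}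
    {V V' : ℝ → Ω → ℝ} (hV : PotentialAssumption V P) (h : IsModification V' V P) :
    PotentialAssumption V' P where
  centeredGaussian := hV.centeredGaussian.congr h
  contDiff_cov := by
    simp only [h.covariance_eq]
    exact hV.contDiff_cov
  lipschitz_mixed := by
    simp only [h.covariance_eq]
    exact hV.lipschitz_mixed

end Modification

/-! ### Increments of the initial processes -/

/-- The mean value inequality on a single line; total differentiability of `f` is not available from
its partial derivatives. -/
lemma abs_sub_le_of_lineDeriv_le {E : Type*} [AddCommGroup E] [Module ℝ E] {f : E → ℝ} {p v : E}
    {a K : ℝ} (h : ∀ τ ∈ Set.uIcc 0 a, LineDifferentiableAt ℝ f (p + τ • v) v ∧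
      |lineDeriv ℝ f (p + τ • v) v| ≤ K) : |f (p + a • v) - f p| ≤ K * |a| := by
  have hd : ∀ τ ∈ Set.uIcc 0 a, HasDerivWithinAt (fun τ : ℝ => f (p + τ • v))
      (lineDeriv ℝ f (p + τ • v) v) (Set.uIcc 0 a) τ := by
    intro τ hτ
    have h0 : HasDerivAt (fun t : ℝ => f (p + τ • v + t • v)) (lineDeriv ℝ f (p + τ • v) v)
        (τ - τ) := by
      rw [sub_self]
      exact (h τ hτ).1.hasLineDerivAt
    have h1 := h0.comp_sub_const τ τ
    simp only [add_assoc, ← add_smul, add_sub_cancel] at h1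
    exact h1.hasDerivWithinAt
  have := Convex.norm_image_sub_le_of_norm_hasDerivWithin_le hd
    (fun τ hτ => (Real.norm_eq_abs _).trans_le (h τ hτ).2) (convex_uIcc 0 a)
    Set.left_mem_uIcc Set.right_mem_uIcc
  simpa using this

/-- The coordinates of a point of the plane. -/
def coords (v : Plane) : ℝ × ℝ := (v 0, v 1)

lemma dist_coords_le (s t : Plane) : dist (coords s) (coords t) ≤ dist s t := by
  rw [Prod.dist_eq, EuclideanSpace.dist_eq, Fin.sum_univ_two]
  refine max_le (Real.le_sqrt_of_sq_le ?_) (Real.le_sqrt_of_sq_le ?_)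
  · exact le_add_of_nonneg_right (sq_nonneg _)
  · exact le_add_of_nonneg_left (sq_nonneg _)

lemma dist_le_two_mul {s t : Plane} {d : ℝ} (h0 : |s 0 - t 0| ≤ d) (h1 : |s 1 - t 1| ≤ d) :
    dist s t ≤ 2 * d := by
  have hd : 0 ≤ d := (abs_nonneg _).trans h0
  rw [EuclideanSpace.dist_eq, Fin.sum_univ_two, Real.dist_eq, Real.dist_eq]
  refine Real.sqrt_le_iff.2 ⟨by positivity, ?_⟩
  have h0' := pow_le_pow_left₀ (abs_nonneg _) h0 2
  have h1' := pow_le_pow_left₀ (abs_nonneg _) h1 2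
  nlinarith

/-- Go from `(s, s)` to `(s, t)` along two axis-parallel segments in the second variable. They may
leave `S × S`, but compactness gives a uniform thickening inside `U` that contains them for nearby
`s` and `t`. -/
lemma exists_abs_sub_diag_le {S : Set Plane} (hS : IsCompact S) {c : S → S → ℝ}
    (hc : HasBoundedPartials S c) :
    ∃ K δ : ℝ, 0 < δ ∧ ∀ s t : S, dist (coords s) (coords t) < δ →
      |c s s - c s t| ≤ K * dist (coords s) (coords t) := by
  obtain ⟨U, f, K, hU, hSU, hfc, hf⟩ := hc
  obtain ⟨δ, hδ, hδU⟩ := (hS.prod hS).exists_thickening_subset_open hU hSU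
  -- One `K` per segment; `δ / 2` because coordinate distance `d` allows Euclidean distance up to `2
  -- * d`.
  refine ⟨K + K, δ / 2, by positivity, fun s t hst => ?_⟩
  set d := dist (coords s) (coords t) with hd
  have hd0 : 0 ≤ d := dist_nonneg
  have hdd := max_le_iff.1 (hd ▸ Prod.dist_eq (x := coords s) (y := coords t)).ge
  have h0 : |(t : Plane) 0 - (s : Plane) 0| ≤ d := by
    rw [abs_sub_comm]; exact hdd.1
  have h1 : |(t : Plane) 1 - (s : Plane) 1| ≤ d := by
    rw [abs_sub_comm]; exact hdd.2
  have hnear : ∀ x : Plane, |x 0 - (s : Plane) 0| ≤ d → |x 1 - (s : Plane) 1| ≤ d →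
      ((s : Plane), x) ∈ U := by
    intro x hx0 hx1
    refine hδU (Metric.mem_thickening_iff.2 ⟨((s : Plane), (s : Plane)), ⟨s.2, s.2⟩, ?_⟩)
    rw [Prod.dist_eq, dist_self, max_eq_right dist_nonneg]
    exact (dist_le_two_mul hx0 hx1).trans_lt (by linarith)
  have hK : 0 ≤ K := (abs_nonneg _).trans (hf _ (hnear s (by simpa) (by simpa)) 0).2.1
  have hseg : ∀ {a τ : ℝ}, |a| ≤ d → τ ∈ Set.uIcc 0 a → |τ| ≤ d := by
    intro a τ ha hτ
    have := Set.abs_sub_left_of_mem_uIcc hτ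
    simp only [sub_zero] at this
    exact this.trans ha
  set m : Plane := (s : Plane) + ((t : Plane) 0 - (s : Plane) 0) • EuclideanSpace.single 0 1
    with hm
  have e1 : (((s : Plane), (s : Plane)) : Plane × Plane) +
      ((t : Plane) 0 - (s : Plane) 0) • ((0 : Plane), (EuclideanSpace.single 0 1 : Plane)) =
      ((s : Plane), m) := by
    ext : 1 <;> simp [hm]
  have e2 : (((s : Plane), m) : Plane × Plane) +
      ((t : Plane) 1 - (s : Plane) 1) • ((0 : Plane), (EuclideanSpace.single 1 1 : Plane)) =
      ((s : Plane), (t : Plane)) := by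
    ext : 1
    · simp
    · ext i
      fin_cases i <;> simp [hm]
  have b1 := abs_sub_le_of_lineDeriv_le (f := f) (p := ((s : Plane), (s : Plane)))
    (v := ((0 : Plane), (EuclideanSpace.single 0 1 : Plane))) (K := K)
    (a := (t : Plane) 0 - (s : Plane) 0) (fun τ hτ => by
      have := hf _ (hnear ((s : Plane) + τ • EuclideanSpace.single 0 1)
        (by simpa using hseg h0 hτ) (by simpa)) 0
      have e : (((s : Plane), (s : Plane)) : Plane × Plane) +
          τ • ((0 : Plane), (EuclideanSpace.single 0 1 : Plane)) =
          ((s : Plane), (s : Plane) + τ • EuclideanSpace.single 0 1) := by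
        ext : 1 <;> simp
      rw [e]
      exact this.2.2)
  have b2 := abs_sub_le_of_lineDeriv_le (f := f) (p := ((s : Plane), m))
    (v := ((0 : Plane), (EuclideanSpace.single 1 1 : Plane))) (K := K)
    (a := (t : Plane) 1 - (s : Plane) 1) (fun τ hτ => by
      have := hf _ (hnear (m + τ • EuclideanSpace.single 1 1)
        (by simpa [hm] using h0) (by simpa [hm] using hseg h1 hτ)) 1
      have e : (((s : Plane), m) : Plane × Plane) +
          τ • ((0 : Plane), (EuclideanSpace.single 1 1 : Plane)) =
          ((s : Plane), m + τ • EuclideanSpace.single 1 1) := by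
        ext : 1 <;> simp
      rw [e]
      exact this.2.2)
  rw [e1] at b1
  rw [e2] at b2
  rw [← hfc, ← hfc, abs_sub_comm]
  calc |f (↑s, ↑t) - f (↑s, ↑s)|
      ≤ |f (↑s, ↑t) - f (↑s, m)| + |f (↑s, m) - f (↑s, ↑s)| := abs_sub_le _ _ _
    _ ≤ K * d + K * d := by
        refine add_le_add (b2.trans ?_) (b1.trans ?_) <;> gcongr
    _ = (K + K) * d := by ring

lemma InitialAssumption.exists_variance_sub_le {Ω : Type*} [MeasurableSpace Ω] {P : Measure Ω}
    {S : Set Plane} (hS : IsCompact S) {Z : S → Ω → ℝ} (hZ : InitialAssumption S Z P) :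
    ∃ C δ : ℝ, 0 < δ ∧ ∀ s t : S, dist (coords s) (coords t) < δ →
      Var[Z s - Z t; P] ≤ C * dist (coords s) (coords t) := by
  obtain ⟨K, δ, hδ, h⟩ := exists_abs_sub_diag_le hS hZ.boundedPartials
  refine ⟨K + K, δ, hδ, fun s t hst => ?_⟩
  rw [hZ.centeredGaussian.variance_sub, add_mul]
  refine add_le_add ((le_abs_self _).trans (h s t hst)) ((le_abs_self _).trans ?_)
  rw [dist_comm] at hst ⊢
  exact h t s hst

/-! ### Difference quotients of the random potential -/

/-- The difference quotient of a random function between two points. -/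
def slopeProcess {Ω : Type*} (V : ℝ → Ω → ℝ) (p : ℝ × ℝ) (ω : Ω) : ℝ :=
  (p.2 - p.1)⁻¹ * (V p.2 ω - V p.1 ω)

section Slope

variable {Ω : Type*} [MeasurableSpace Ω] {P : Measure Ω} {V : ℝ → Ω → ℝ}

lemma IsCenteredGaussian.slopeProcess (hV : IsCenteredGaussian V P) :
    IsCenteredGaussian (slopeProcess V) P where
  gaussian := by
    classical
    exact hV.gaussian.of_isGaussianProcess fun p => ⟨{p.1, p.2},
      (p.2 - p.1)⁻¹ • (ContinuousLinearMap.proj ⟨p.2, by simp⟩ -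
        ContinuousLinearMap.proj ⟨p.1, by simp⟩), fun ω => by
        simp [HamiltonianST.slopeProcess]⟩
  centered p := by
    simp only [HamiltonianST.slopeProcess]
    rw [integral_const_mul, integral_sub (hV.gaussian.hasGaussianLaw_eval _).integrable
      (hV.gaussian.hasGaussianLaw_eval _).integrable, hV.centered, hV.centered]
    simp

lemma IsCenteredGaussian.covariance_slopeProcess (hV : IsCenteredGaussian V P) (p q : ℝ × ℝ) :
    covariance (HamiltonianST.slopeProcess V p) (HamiltonianST.slopeProcess V q) P =
      (p.2 - p.1)⁻¹ * ((q.2 - q.1)⁻¹ *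
        ((covariance (V p.2) (V q.2) P - covariance (V p.1) (V q.2) P) -
          (covariance (V p.2) (V q.1) P - covariance (V p.1) (V q.1) P))) := by
  have := hV.gaussian.isProbabilityMeasure
  have e : ∀ p : ℝ × ℝ, HamiltonianST.slopeProcess V p =
      (p.2 - p.1)⁻¹ • (V p.2 - V p.1) := fun p => rfl
  have hm := hV.memLp
  rw [e, e, covariance_smul_left, covariance_smul_right,
    covariance_sub_left (hm _) (hm _) ((hm _).sub (hm _)),
    covariance_sub_right (hm _) (hm _) (hm _), covariance_sub_right (hm _) (hm _) (hm _)]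
  ring

/-- Normalized mixed second differences over rectangles inherit a Lipschitz bound from the mixed
partial derivative. -/
lemma abs_mixed_difference_sub_le {c : ℝ → ℝ → ℝ} (hc : ContDiff ℝ 2 fun p : ℝ × ℝ => c p.1 p.2)
    {K : NNReal} (hK : LipschitzWith K fun p : ℝ × ℝ =>
      deriv (fun x₁ => deriv (fun x₂ => c x₁ x₂) p.2) p.1)
    {p q r : ℝ × ℝ} (hp : p.1 ≠ p.2) (hq : q.1 ≠ q.2) (hr : r.1 ≠ r.2) :
    |(p.2 - p.1)⁻¹ * ((q.2 - q.1)⁻¹ * ((c p.2 q.2 - c p.1 q.2) - (c p.2 q.1 - c p.1 q.1))) -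
      (p.2 - p.1)⁻¹ * ((r.2 - r.1)⁻¹ * ((c p.2 r.2 - c p.1 r.2) - (c p.2 r.1 - c p.1 r.1)))| ≤
      K * dist q r := by
  set c₂ : ℝ → ℝ → ℝ := fun x y => deriv (fun y => c x y) y with hc₂
  have hd₂ : ∀ x y, HasDerivAt (fun y => c x y) (c₂ x y) y := by
    intro x y
    have : Differentiable ℝ (fun y => c x y) :=
      (hc.differentiable (by norm_num)).comp (f := fun y : ℝ => ((x, y) : ℝ × ℝ)) (by fun_prop)
    exact (this y).hasDerivAt
  have hd₁₂ : ∀ x y, HasDerivAt (fun x => c₂ x y) (deriv (fun x => c₂ x y) x) x := by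
    intro x y
    have e : (fun x => c₂ x y) =
        fun x => fderiv ℝ (fun p : ℝ × ℝ => c p.1 p.2) (x, y) (0, 1) := by
      ext x
      have h1 : HasFDerivAt (fun p : ℝ × ℝ => c p.1 p.2)
          (fderiv ℝ (fun p : ℝ × ℝ => c p.1 p.2) (x, y)) (x, y) :=
        (hc.differentiable (by norm_num) _).hasFDerivAt
      have h2 : HasDerivAt (fun y : ℝ => ((x, y) : ℝ × ℝ)) (0, 1) y :=
        (hasDerivAt_const y x).prodMk (hasDerivAt_id y)
      exact (h1.comp_hasDerivAt y h2).deriv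
    have hdiff : Differentiable ℝ (fun x => c₂ x y) := by
      rw [e]
      have h := (hc.fderiv_right (m := 1) (by norm_num)).differentiable (by norm_num)
      have h' : Differentiable ℝ fun x : ℝ =>
          fderiv ℝ (fun p : ℝ × ℝ => c p.1 p.2) (x, y) :=
        h.comp (f := fun x : ℝ => ((x, y) : ℝ × ℝ)) (by fun_prop)
      exact h'.clm_apply (differentiable_const _)
    exact (hdiff x).hasDerivAt
  have hline : ∀ u v b : ℝ, HasDerivAt (fun b => u + b * (v - u)) (v - u) b := by
    intro u v b
    simpa using ((hasDerivAt_id b).mul_const (v - u)).const_add u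
  have hp' : p.2 - p.1 ≠ 0 := sub_ne_zero.2 hp.symm
  have hq' : q.2 - q.1 ≠ 0 := sub_ne_zero.2 hq.symm
  have hr' : r.2 - r.1 ≠ 0 := sub_ne_zero.2 hr.symm
  -- Both rectangles are parametrized by the same unit square, so corresponding points share their
  -- first coordinate and differ in the second by a convex combination of `q.1 - r.1` and `q.2 -
  -- r.2`. The mean value inequality in the first variable then brings in the mixed partial.
  have hinner : ∀ b ∈ Set.Icc (0 : ℝ) 1,
      |(c₂ p.2 (q.1 + b * (q.2 - q.1)) - c₂ p.2 (r.1 + b * (r.2 - r.1))) -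
        (c₂ p.1 (q.1 + b * (q.2 - q.1)) - c₂ p.1 (r.1 + b * (r.2 - r.1)))| ≤
        |p.2 - p.1| * (K * dist q r) := by
    intro b hb
    set y := q.1 + b * (q.2 - q.1) with hy
    set z := r.1 + b * (r.2 - r.1) with hz
    have hyz : |y - z| ≤ dist q r := by
      have h1 : |q.1 - r.1| ≤ dist q r := le_max_left (dist q.1 r.1) _
      have h2 : |q.2 - r.2| ≤ dist q r := le_max_right _ (dist q.2 r.2)
      have e : y - z = (1 - b) * (q.1 - r.1) + b * (q.2 - r.2) := by rw [hy, hz]; ring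
      rw [e]
      calc |(1 - b) * (q.1 - r.1) + b * (q.2 - r.2)|
          ≤ |(1 - b) * (q.1 - r.1)| + |b * (q.2 - r.2)| := abs_add_le _ _
        _ = (1 - b) * |q.1 - r.1| + b * |q.2 - r.2| := by
            rw [abs_mul, abs_mul, abs_of_nonneg hb.1, abs_of_nonneg (sub_nonneg.2 hb.2)]
        _ ≤ (1 - b) * dist q r + b * dist q r :=
            add_le_add (mul_le_mul_of_nonneg_left h1 (sub_nonneg.2 hb.2))
              (mul_le_mul_of_nonneg_left h2 hb.1)
        _ = dist q r := by ring
    have h := norm_image_sub_le_of_norm_deriv_le_segment_01'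
      (f := fun a => c₂ (p.1 + a * (p.2 - p.1)) y - c₂ (p.1 + a * (p.2 - p.1)) z)
      (f' := fun a => deriv (fun x => c₂ x y) (p.1 + a * (p.2 - p.1)) * (p.2 - p.1) -
        deriv (fun x => c₂ x z) (p.1 + a * (p.2 - p.1)) * (p.2 - p.1))
      (C := |p.2 - p.1| * (K * dist q r))
      (fun a _ => (((hd₁₂ _ y).comp a (hline p.1 p.2 a)).sub
        ((hd₁₂ _ z).comp a (hline p.1 p.2 a))).hasDerivWithinAt) (fun a _ => ?_)
    · simpa [Real.norm_eq_abs] using h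
    · rw [← sub_mul, norm_mul, mul_comm, Real.norm_eq_abs]
      refine mul_le_mul_of_nonneg_left ?_ (abs_nonneg _)
      have := hK.dist_le_mul (p.1 + a * (p.2 - p.1), y) (p.1 + a * (p.2 - p.1), z)
      rw [Prod.dist_eq, dist_self, max_eq_right dist_nonneg] at this
      exact this.trans (mul_le_mul_of_nonneg_left hyz K.2)
  -- The mean value inequality again, now in the second variable. The chain-rule factors `q.2 - q.1`
  -- and `r.2 - r.1` cancel the normalizations, leaving `hinner` divided by `|p.2 - p.1|`.
  have h := norm_image_sub_le_of_norm_deriv_le_segment_01'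
    (f := fun b => (p.2 - p.1)⁻¹ * ((q.2 - q.1)⁻¹ *
      (c p.2 (q.1 + b * (q.2 - q.1)) - c p.1 (q.1 + b * (q.2 - q.1)))) -
      (p.2 - p.1)⁻¹ * ((r.2 - r.1)⁻¹ *
      (c p.2 (r.1 + b * (r.2 - r.1)) - c p.1 (r.1 + b * (r.2 - r.1)))))
    (f' := fun b => (p.2 - p.1)⁻¹ * ((q.2 - q.1)⁻¹ *
      (c₂ p.2 (q.1 + b * (q.2 - q.1)) * (q.2 - q.1) -
        c₂ p.1 (q.1 + b * (q.2 - q.1)) * (q.2 - q.1))) -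
      (p.2 - p.1)⁻¹ * ((r.2 - r.1)⁻¹ *
      (c₂ p.2 (r.1 + b * (r.2 - r.1)) * (r.2 - r.1) -
        c₂ p.1 (r.1 + b * (r.2 - r.1)) * (r.2 - r.1))))
    (C := K * dist q r)
    (fun b _ => HasDerivAt.hasDerivWithinAt <|
      ((((((hd₂ p.2 _).comp b (hline q.1 q.2 b)).sub
        ((hd₂ p.1 _).comp b (hline q.1 q.2 b))).const_mul _).const_mul _).sub
      (((((hd₂ p.2 _).comp b (hline r.1 r.2 b)).sub
        ((hd₂ p.1 _).comp b (hline r.1 r.2 b))).const_mul _).const_mul _)))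
    (fun b hb => ?_)
  · rw [Real.norm_eq_abs] at h
    refine le_trans (le_of_eq ?_) h
    simp only [one_mul, zero_mul, add_zero, add_sub_cancel]
    congr 1
    ring
  · have := hinner b ⟨hb.1, hb.2.le⟩
    rw [← sub_mul, ← sub_mul, mul_comm _ (q.2 - q.1), mul_comm _ (r.2 - r.1),
      inv_mul_cancel_left₀ hq', inv_mul_cancel_left₀ hr', ← mul_sub, norm_mul, norm_inv,
      Real.norm_eq_abs, Real.norm_eq_abs, inv_mul_le_iff₀ (abs_pos.2 hp')]
    refine le_trans (le_of_eq ?_) this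
    congr 1
    ring

lemma PotentialAssumption.exists_variance_slopeProcess_sub_le (hV : PotentialAssumption V P) :
    ∃ C : ℝ, ∀ p q : ℝ × ℝ, p.1 ≠ p.2 → q.1 ≠ q.2 →
      Var[slopeProcess V p - slopeProcess V q; P] ≤ C * dist p q := by
  obtain ⟨K, hK⟩ := hV.lipschitz_mixed
  have hcg := hV.centeredGaussian
  refine ⟨K + K, fun p q hp hq => ?_⟩
  rw [hcg.slopeProcess.variance_sub, add_mul]
  simp only [hcg.covariance_slopeProcess]
  refine add_le_add
    ((le_abs_self _).trans (abs_mixed_difference_sub_le hV.contDiff_cov hK hp hp hq))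
    ((le_abs_self _).trans ?_)
  rw [dist_comm]
  exact abs_mixed_difference_sub_le hV.contDiff_cov hK hq hq hp

end Slope

/-! ### Regular extensions of sample paths from countable sets -/

/-- A function on a dense set that is locally uniformly continuous there extends continuously. -/
lemma exists_continuous_extension {T : Type*} [PseudoMetricSpace T] {A : Set T} (hA : Dense A)
    {f : T → ℝ} (hf : ∀ x, ∃ U ∈ 𝓝 x, UniformContinuousOn f (A ∩ U)) :
    ∃ g : T → ℝ, Continuous g ∧ Set.EqOn g f A := by
  refine ⟨extendFrom A f, continuous_extendFrom hA fun x => ?_, fun x hx => ?_⟩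
  · obtain ⟨U, hU, hfU⟩ := hf x
    have : (𝓝[A] x).NeBot := mem_closure_iff_nhdsWithin_neBot.1 (hA x)
    have hle : 𝓝[A] x ≤ 𝓟 (A ∩ U) := by
      rw [le_principal_iff]
      exact inter_mem self_mem_nhdsWithin (mem_nhdsWithin_of_mem_nhds hU)
    exact CompleteSpace.complete ((cauchy_nhds.mono nhdsWithin_le_nhds).map_of_le hfU hle)
  · refine extendFrom_extends (fun y hy => ?_) x hx
    obtain ⟨U, hU, hfU⟩ := hf y
    exact (continuousWithinAt_inter hU).1 (hfU.continuousOn y ⟨hy, mem_of_mem_nhds hU⟩)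

lemma dense_offDiag {D : Set ℝ} (hD : Dense D) :
    Dense {p : ℝ × ℝ | p.1 ∈ D ∧ p.2 ∈ D ∧ p.1 ≠ p.2} := by
  intro p
  refine Metric.mem_closure_iff.2 fun ε hε => ?_
  obtain ⟨u, hu, hpu⟩ := Metric.mem_closure_iff.1 (hD p.1) ε hε
  obtain ⟨v, hv, hpv⟩ := Metric.mem_closure_iff.1 ((hD.sdiff_singleton u) p.2) ε hε
  refine ⟨(u, v), ⟨hu, hv.1, fun h => hv.2 h.symm⟩, ?_⟩
  rw [Prod.dist_eq]
  exact max_lt hpu hpv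

/-- A function on a dense set whose difference quotients are locally uniformly continuous extends
to a continuously differentiable function. -/
lemma exists_contDiff_extension {D : Set ℝ} (hD : Dense D) {f : ℝ → ℝ}
    (hf : ∀ N : ℕ, UniformContinuousOn (fun p : ℝ × ℝ => (p.2 - p.1)⁻¹ * (f p.2 - f p.1))
      ({p | p.1 ∈ D ∧ p.2 ∈ D ∧ p.1 ≠ p.2} ∩ Metric.closedBall 0 N)) :
    ∃ g : ℝ → ℝ, Differentiable ℝ g ∧ Continuous (deriv g) ∧ Set.EqOn g f D := by
  obtain ⟨G, hG, hGf⟩ := exists_continuous_extension (dense_offDiag hD)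
    (f := fun p : ℝ × ℝ => (p.2 - p.1)⁻¹ * (f p.2 - f p.1)) fun x => by
      obtain ⟨N, hN⟩ := exists_nat_gt (dist x 0)
      exact ⟨_, Metric.closedBall_mem_nhds_of_mem (Metric.mem_ball.2 hN), hf N⟩
  obtain ⟨d, hd⟩ := hD.nonempty
  -- Recover the function from its slopes at a base point `d`.
  set g : ℝ → ℝ := fun x => f d + G (d, x) * (x - d) with hg
  have hgf : Set.EqOn g f D := by
    intro x hx
    rcases eq_or_ne d x with rfl | hdx
    · simp [hg]
    · have := hGf (show (d, x) ∈ {p : ℝ × ℝ | p.1 ∈ D ∧ p.2 ∈ D ∧ p.1 ≠ p.2} from ⟨hd, hx, hdx⟩)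
      simp only [hg, this]
      have h : x - d ≠ 0 := sub_ne_zero.2 hdx.symm
      field_simp
      ring
  have hgc : Continuous g := by fun_prop
  -- Both sides are continuous and agree on the dense set of off-diagonal pairs from `D`; letting `v
  -- → u` then identifies `G (u, u)` as the derivative.
  have hslope : ∀ u v, G (u, v) * (v - u) = g v - g u := by
    have h : (fun p : ℝ × ℝ => G p * (p.2 - p.1)) = fun p => g p.2 - g p.1 := by
      refine Continuous.ext_on (dense_offDiag hD) (by fun_prop) (by fun_prop) fun p hp => ?_
      have h : p.2 - p.1 ≠ 0 := sub_ne_zero.2 hp.2.2.symm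
      simp only [hGf hp, hgf hp.1, hgf hp.2.1]
      field_simp
    exact fun u v => congrFun h (u, v)
  have hderiv : ∀ u, HasDerivAt g (G (u, u)) u := by
    intro u
    rw [hasDerivAt_iff_tendsto_slope]
    have h : Tendsto (fun v => G (u, v)) (𝓝[≠] u) (𝓝 (G (u, u))) :=
      ((hG.comp (by fun_prop : Continuous fun v : ℝ => (u, v))).tendsto u).mono_left
        nhdsWithin_le_nhds
    refine h.congr' ?_
    filter_upwards [self_mem_nhdsWithin] with v hv
    rw [slope_def_field, eq_div_iff (sub_ne_zero.2 hv), hslope]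
  refine ⟨g, fun u => (hderiv u).differentiableAt, ?_, hgf⟩
  rw [funext fun u => (hderiv u).deriv]
  fun_prop

section Extension

variable {Ω : Type*} [MeasurableSpace Ω] {P : Measure Ω}

lemma InitialAssumption.ae_exists_continuous {S : Set Plane} (hS : IsCompact S) {Z : S → Ω → ℝ}
    (hZ : InitialAssumption S Z P) {D : Set S} (hD : D.Countable) :
    ∀ᵐ ω ∂P, ∃ g : S → ℝ, Continuous g ∧ Set.EqOn g (fun s => Z s ω) D := by
  obtain ⟨E, hE, hEd⟩ := TopologicalSpace.exists_countable_dense S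
  -- Enlarging `D` to a countable dense set makes a continuous extension to all of `S` possible.
  set A := D ∪ E with hA
  have hAd : Dense A := hEd.mono Set.subset_union_right
  have : Countable A := (hD.union hE).to_subtype
  obtain ⟨r, hr⟩ := hS.isBounded.subset_closedBall 0
  obtain ⟨R, hR⟩ := exists_nat_ge r
  have hbound : ∀ s : S, |(coords s).1| ≤ R ∧ |(coords s).2| ≤ R := by
    intro s
    have h1 : dist (s : Plane) 0 ≤ R := (Metric.mem_closedBall.1 (hr s.2)).trans hR
    have h2 := (dist_coords_le s 0).trans h1
    simpa [Prod.dist_eq, coords] using h2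
  obtain ⟨C, δ, hδ, hvar⟩ := hZ.exists_variance_sub_le hS
  have hae := ae_uniformContinuous_of_gaussian (φ := fun a : A => coords (a : S))
    (fun a => hbound a) (hZ.centeredGaussian.comp fun a : A => (a : S)) hδ
    (fun a b hab => hvar a b hab)
  filter_upwards [hae] with ω hω
  obtain ⟨g, hg, hgA⟩ := exists_continuous_extension hAd (f := fun s => Z s ω) fun x =>
    ⟨Set.univ, univ_mem, by
      rw [Set.inter_univ, Metric.uniformContinuousOn_iff]
      intro ε hε
      obtain ⟨η, hη, h⟩ := hω ε hε
      exact ⟨η, hη, fun a ha b hb hab =>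
        h ⟨a, ha⟩ ⟨b, hb⟩ ((dist_coords_le (a : Plane) b).trans_lt hab)⟩⟩
  exact ⟨g, hg, hgA.mono Set.subset_union_left⟩

lemma PotentialAssumption.ae_exists_contDiff {V : ℝ → Ω → ℝ} (hV : PotentialAssumption V P)
    {D : Set ℝ} (hD : D.Countable) :
    ∀ᵐ ω ∂P, ∃ g : ℝ → ℝ, Differentiable ℝ g ∧ Continuous (deriv g) ∧
      Set.EqOn g (fun u => V u ω) D := by
  obtain ⟨E, hE, hEd⟩ := TopologicalSpace.exists_countable_dense ℝ
  set A := D ∪ E with hA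
  have hAd : Dense A := hEd.mono Set.subset_union_right
  have hAc : A.Countable := hD.union hE
  obtain ⟨C, hvar⟩ := hV.exists_variance_slopeProcess_sub_le
  have hae : ∀ᵐ ω ∂P, ∀ N : ℕ, UniformContinuousOn (fun p => slopeProcess V p ω)
      ({p | p.1 ∈ A ∧ p.2 ∈ A ∧ p.1 ≠ p.2} ∩ Metric.closedBall 0 N) := by
    refine ae_all_iff.2 fun N => ?_
    -- The variance bound for slopes holds only off the diagonal, and the criterion needs a bounded
    -- index set, hence one countable family for each `N`.
    set B : Set (ℝ × ℝ) := {p | p.1 ∈ A ∧ p.2 ∈ A ∧ p.1 ≠ p.2} ∩ Metric.closedBall 0 N with hB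
    have hBA : B ⊆ A ×ˢ A := fun p hp => ⟨hp.1.1, hp.1.2.1⟩
    have : Countable B := ((hAc.prod hAc).mono hBA).to_subtype
    have hbound : ∀ p : B, |(p : ℝ × ℝ).1| ≤ N ∧ |(p : ℝ × ℝ).2| ≤ N := by
      intro p
      simpa [Prod.dist_eq, Prod.norm_def] using p.2.2
    have h := ae_uniformContinuous_of_gaussian (φ := fun p : B => (p : ℝ × ℝ)) hbound
      (hV.centeredGaussian.slopeProcess.comp fun p : B => (p : ℝ × ℝ)) one_pos
      (fun p q _ => hvar p q p.2.1.2.2 q.2.1.2.2)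
    filter_upwards [h] with ω hω
    rw [Metric.uniformContinuousOn_iff]
    intro ε hε
    obtain ⟨η, hη, h⟩ := hω ε hε
    exact ⟨η, hη, fun a ha b hb hab => h ⟨a, ha⟩ ⟨b, hb⟩ hab⟩
  filter_upwards [hae] with ω hω
  obtain ⟨g, h1, h2, h3⟩ := exists_contDiff_extension hAd (f := fun u => V u ω) hω
  exact ⟨g, h1, h2, h3.mono Set.subset_union_left⟩

/-! ### Separable versions -/

variable {T : Type*} [TopologicalSpace T] {Z : T → Ω → ℝ}

/-- The predicate `p` lets the same argument yield continuity for the initial processes and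
continuous differentiability for `V`. -/
lemma IsSeparableProcess.ae_eq_of_extension (hZ : IsSeparableProcess Z P) {p : (T → ℝ) → Prop}
    (hp : ∀ g, p g → Continuous g)
    (hext : ∀ D : Set T, D.Countable → ∀ᵐ ω ∂P, ∃ g, p g ∧ Set.EqOn g (fun t => Z t ω) D) :
    ∀ᵐ ω ∂P, p fun t => Z t ω := by
  obtain ⟨D, hD, hsep⟩ := hZ
  filter_upwards [hsep, hext D hD] with ω h1 h2
  obtain ⟨g, hg, hgD⟩ := h2
  have hZg : (fun t => Z t ω) = g := by
    ext t
    have hsub : (fun d => (d, Z d ω)) '' D ⊆ {q : T × ℝ | q.2 = g q.1} := by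
      rintro _ ⟨d, hd, rfl⟩
      exact (hgD hd).symm
    exact closure_minimal hsub
      (isClosed_eq continuous_snd ((hp g hg).comp continuous_fst)) (h1 t)
  rwa [hZg]

lemma exists_separable_version [TopologicalSpace.SeparableSpace T]
    (hext : ∀ D : Set T, D.Countable →
      ∀ᵐ ω ∂P, ∃ g : T → ℝ, Continuous g ∧ Set.EqOn g (fun t => Z t ω) D) :
    ∃ Z' : T → Ω → ℝ, IsModification Z' Z P ∧ IsSeparableProcess Z' P := by
  classical
  obtain ⟨D, hD, hDd⟩ := TopologicalSpace.exists_countable_dense T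
  have hex : ∀ ω, ∃ g : T → ℝ, Continuous g ∧
      ((∃ g' : T → ℝ, Continuous g' ∧ Set.EqOn g' (fun t => Z t ω) D) →
        Set.EqOn g (fun t => Z t ω) D) := by
    intro ω
    by_cases h : ∃ g' : T → ℝ, Continuous g' ∧ Set.EqOn g' (fun t => Z t ω) D
    · obtain ⟨g, hg, hgD⟩ := h
      exact ⟨g, hg, fun _ => hgD⟩
    · exact ⟨0, continuous_const, fun h' => (h h').elim⟩
  choose G hG hGD using hex
  refine ⟨fun t ω => G ω t, fun t => ?_, D, hD, Eventually.of_forall fun ω t => ?_⟩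
  -- Extending from `insert t D` gives a continuous function through `Z t ω`; by density of `D` it
  -- must coincide with `G ω`.
  · filter_upwards [hext (insert t D) (hD.insert t)] with ω hω
    obtain ⟨g, hg, hgD⟩ := hω
    have hgD' : Set.EqOn g (fun t => Z t ω) D := hgD.mono (Set.subset_insert _ _)
    have h : G ω = g := Continuous.ext_on hDd (hG ω) hg
      ((hGD ω ⟨g, hg, hgD'⟩).trans hgD'.symm)
    rw [h]
    exact hgD (Set.mem_insert _ _)
  · exact image_closure_subset_closure_image
      (f := fun d => (d, G ω d)) (continuous_id.prodMk (hG ω)) ⟨t, hDd t, rfl⟩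

end Extension

/-! ### The dynamics -/

lemma continuous_mass {S : Set Plane} (hS : IsCompact S) : Continuous (mass S) := by
  have hsq : Continuous sqVec := by
    unfold sqVec
    fun_prop
  refine Real.continuous_exp.comp (hS.continuous_sSup
    (f := fun s u => ‖sqVec s - sqVec u‖ ^ 2) ?_)
  exact ((hsq.comp continuous_fst).sub (hsq.comp continuous_snd)).norm.pow 2

lemma continuous_leapfrog {S : Set Plane} (hS : IsCompact S) (α β δt : ℝ) {v : ℝ → ℝ}
    (hv : Continuous (deriv v)) {y₀ x₀ : S → ℝ} (hy : Continuous y₀) (hx : Continuous x₀) (h : ℕ) :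
    Continuous (leapfrog S α β δt v y₀ x₀ h).1 ∧ Continuous (leapfrog S α β δt v y₀ x₀ h).2 := by
  induction h with
  | zero => exact ⟨hy, hx⟩
  | succ h ih =>
    obtain ⟨hy, hx⟩ := ih
    have hm : Continuous fun s : S => (mass S s)⁻¹ :=
      ((continuous_mass hS).comp continuous_subtype_val).inv₀ fun s => (Real.exp_pos _).ne'
    have hy' : Continuous (leapfrog S α β δt v y₀ x₀ (h + 1)).1 := by
      simp only [leapfrog]
      fun_prop
    refine ⟨hy', ?_⟩
    -- The update of `X` uses the already updated `Y`, so in this form `hy'` applies directly.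
    have e : (leapfrog S α β δt v y₀ x₀ (h + 1)).2 = fun s =>
        α ^ 2 * (leapfrog S α β δt v y₀ x₀ h).2 s - δt / 2 *
          (α * deriv v ((leapfrog S α β δt v y₀ x₀ h).1 s) +
            deriv v ((leapfrog S α β δt v y₀ x₀ (h + 1)).1 s)) := rfl
    rw [e]
    fun_prop

end HamiltonianST

end

theorem theorem2 {Ω : Type*} [MeasurableSpace Ω] (P : Measure Ω) [IsProbabilityMeasure P]
    (S : Set HamiltonianST.Plane) (hS : IsCompact S)
    (α β δt : ℝ) (hα : |α| < 1) (hβ : |β| < 1) (hδt : 0 < δt)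
    (X₀ Y₀ : S → Ω → ℝ) (V : ℝ → Ω → ℝ)
    (hX₀ : HamiltonianST.InitialAssumption S X₀ P)
    (hY₀ : HamiltonianST.InitialAssumption S Y₀ P)
    (hV : HamiltonianST.PotentialAssumption V P) :
    -- separable versions of the three Gaussian processes exist
    (∃ (X Y : S → Ω → ℝ) (W : ℝ → Ω → ℝ),
      (HamiltonianST.IsModification X X₀ P ∧ HamiltonianST.IsSeparableProcess X P) ∧
      (HamiltonianST.IsModification Y Y₀ P ∧ HamiltonianST.IsSeparableProcess Y P) ∧
      (HamiltonianST.IsModification W V P ∧ HamiltonianST.IsSeparableProcess W P)) ∧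
    -- and for all separable versions the model is well defined with continuous sample paths
    ∀ (X Y : S → Ω → ℝ) (W : ℝ → Ω → ℝ),
      HamiltonianST.IsModification X X₀ P → HamiltonianST.IsSeparableProcess X P →
      HamiltonianST.IsModification Y Y₀ P → HamiltonianST.IsSeparableProcess Y P →
      HamiltonianST.IsModification W V P → HamiltonianST.IsSeparableProcess W P →
      ∀ᵐ ω ∂P, Differentiable ℝ (fun u => W u ω) ∧
        ∀ h : ℕ, 1 ≤ h →
          Continuous (fun s : S => HamiltonianST.obsProcess S α β δt W Y X h s ω) ∧
          Continuous (fun s : S => HamiltonianST.latProcess S α β δt W Y X h s ω) := by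
  refine ⟨?_, ?_⟩
  · obtain ⟨X, hX⟩ := HamiltonianST.exists_separable_version fun D hD =>
      hX₀.ae_exists_continuous hS hD
    obtain ⟨Y, hY⟩ := HamiltonianST.exists_separable_version fun D hD =>
      hY₀.ae_exists_continuous hS hD
    obtain ⟨W, hW⟩ := HamiltonianST.exists_separable_version fun D hD =>
      (hV.ae_exists_contDiff hD).mono fun ω ⟨g, h1, _, h3⟩ => ⟨g, h1.continuous, h3⟩
    exact ⟨X, Y, W, hX, hY, hW⟩
  · intro X Y W hX hXs hY hYs hW hWs
    have hXc := hXs.ae_eq_of_extension (p := Continuous) (fun _ h => h) fun D hD =>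
      (hX₀.congr hX).ae_exists_continuous hS hD
    have hYc := hYs.ae_eq_of_extension (p := Continuous) (fun _ h => h) fun D hD =>
      (hY₀.congr hY).ae_exists_continuous hS hD
    have hWc := hWs.ae_eq_of_extension (p := fun g => Differentiable ℝ g ∧ Continuous (deriv g))
      (fun _ h => h.1.continuous) fun D hD =>
      ((hV.congr hW).ae_exists_contDiff hD).mono fun ω ⟨g, h1, h2, h3⟩ => ⟨g, ⟨h1, h2⟩, h3⟩
    filter_upwards [hXc, hYc, hWc] with ω h1 h2 h3
    exact ⟨h3.1, fun h _ => HamiltonianST.continuous_leapfrog hS α β δt h3.2 h2 h1 h⟩
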